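/- **Stabilization with static state feedback.** Consider the discrete-time system $$x(k+1)=A_0x(k)+A_1x(k-h_1(k))+Bu(k-h_2(k)),\qquad k\in\mathbb{Z}_{\ge 0},\qquad (1)$$ with $x(k)\in\mathbb{R}^n$, $u(k)\in\mathbb{R}^m$, constant (unknown) matrices $A_0,A_1\in\mathbb{R}^{n\times n}$, $B\in\mathbb{R}^{n\times m}$, and integer delays bounded by a known $\bar h\in\mathbb{Z}_{>0}$. Data: let $T>\bar h$ be an integer, and let $x_{[-\bar h,T]}$, $u_{[-\bar h,T]}$ be recorded (noise-free) sequences that satisfy (1) for $k=0,\dots,T-1$ with constant, known delays $h_1,h_2\in\{0,\dots,\bar h\}$. Put $$X_{\{i\}}=[x(i)\ \cdots\ x(T+i-1)]\ (i=0,1),\quad X_{h_1,\{0\}}=[x(-h_1)\ \cdots\ x(T-1-h_1)],\quad U_{h_2,\{0\}}=[u(-h_2)\ \cdots\ u(T-1-h_2)],$$ and let $W_0\in\mathbb{R}^{(m+2n)\times T}$ be obtained by stacking $U_{h_2,\{0\}}$, $X_{h_1,\{0\}}$ and $X_{\{0\}}$. Suppose that $\operatorname{rank}(W_0)=m+2n$.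 Let $\varepsilon>0$ and suppose that there are $n\times n$ matrices $\bar P,\bar S,\bar R_1,\bar R_2$ (symmetric positive definite) and $\bar S_{12,1},\bar S_{12,2}$, and $T\times n$ matrices $Q_1,Q_2,Q_3$, such that $$\bar{\mathbf\Phi}=\begin{bmatrix} \bar{\mathbf\Phi}_{11}&\bar{\mathbf\Phi}_{12}&\bar{\mathbf\Phi}_{13}&-\bar S_{12,1}-\bar S_{12,2}&\bar{\mathbf\Phi}_{15}\\ \star&2\bar R_1-\bar S_{12,1}-\bar S_{12,1}^\top&0&-\bar R_1+\bar S_{12,1}&-\varepsilon(X_{\{1\}}Q_2)^\top\\ \star&\star&2\bar R_2-\bar S_{12,2}-\bar S_{12,2}^\top&-\bar R_2+\bar S_{12,2}&-\varepsilon(X_{\{1\}}Q_1)^\top\\ \star&\star&\star&\bar R_1+\bar R_2+\bar S&0\\ \star&\star&\star&\star&\bar{\mathbf\Phi}_{55}\end{bmatrix}>0$$ (here $\star$ denotes the blocks determined by symmetry), where $$\begin{aligned} \bar{\mathbf\Phi}_{11}&=\bar P-\bar S+(1-\bar h^2)(\bar R_1+\bar R_2)-X_{\{1\}}Q_3-(X_{\{1\}}Q_3)^\top,\\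 \bar{\mathbf\Phi}_{12}&=-\bar R_1+\bar S_{12,1}-X_{\{1\}}Q_2,\qquad \bar{\mathbf\Phi}_{13}=-\bar R_2+\bar S_{12,2}-X_{\{1\}}Q_1,\\ \bar{\mathbf\Phi}_{15}&=\bar h^2(\bar R_1+\bar R_2)+X_{\{0\}}Q_3-\varepsilon(X_{\{1\}}Q_3)^\top,\\ \bar{\mathbf\Phi}_{55}&=-\bar P-\bar h^2(\bar R_1+\bar R_2)+\varepsilon(X_{\{0\}}Q_3+Q_3^\top X_{\{0\}}^\top), \end{aligned}$$ $$\begin{bmatrix}\bar R_i&\bar S_{12,i}\\ \bar S_{12,i}^\top&\bar R_i\end{bmatrix}\ge 0,\qquad i=1,2,$$ $$U_{h_2,\{0\}}Q_2=U_{h_2,\{0\}}Q_3=0,\quad X_{h_1,\{0\}}Q_1=X_{h_1,\{0\}}Q_3=0,\quad X_{\{0\}}Q_1=X_{\{0\}}Q_2=0,\quad X_{h_1,\{0\}}Q_2=X_{\{0\}}Q_3.$$ Then $X_{\{0\}}Q_3$ is invertible and, with the gain $K=U_{h_2,\{0\}}Q_1(X_{\{0\}}Q_3)^{-1}$, the origin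 of (1) in closed loop with $u(k)=Kx(k)$ is exponentially stable for all time-varying delays $h_1(k),h_2(k)\in[0,\bar h]$, $k\ge0$: there are $C>0$ and $\rho\in(0,1)$, independent of the delays and of the trajectory, such that $$\|x(k)\|_2\le C\rho^k\max_{-\bar h\le j\le 0}\|x(j)\|_2\qquad\text{for all }k\in\mathbb{Z}_{\ge0}$$ for all such delays, all initial states $x(j)$, $-\bar h\le j\le0$, and all inputs with $u(k)=Kx(k)$ for $k>0$ and past values $u(j)\in\{0,Kx(j)\}$ for $-\bar h\le j\le 0$ (in particular $u(j)=0$). -/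

import Mathlib

open scoped Matrix

/-- The Euclidean norm `√(vᵀ v)` of a vector. -/
noncomputable def euclNorm {n : ℕ} (v : Fin n → ℝ) : ℝ := Real.sqrt (v ⬝ᵥ v)

/-- The delayed signal `k ↦ z (k - h)`, for a constant delay `h`. -/
def delayed {p : ℕ} (z : ℤ → Fin p → ℝ) (h : ℕ) : ℤ → Fin p → ℝ := fun k => z (k - (h : ℤ))

/-- The data matrix `Z_{i} = [z(i) z(i+1) ⋯ z(T+i-1)]`. -/
def dataMatrix {p : ℕ} (z : ℤ → Fin p → ℝ) (i : ℤ) (T : ℕ) : Matrix (Fin p) (Fin T) ℝ :=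
  Matrix.of fun a t => z (i + ((t : ℕ) : ℤ)) a

/-- The matrix `W₀`, obtained by stacking `U_{h₂,{0}}`, `X_{h₁,{0}}` and `X_{0}`. -/
def dataW0 {n m : ℕ} (x : ℤ → Fin n → ℝ) (u : ℤ → Fin m → ℝ) (h₁ h₂ T : ℕ) :
    Matrix (Fin m ⊕ Fin n ⊕ Fin n) (Fin T) ℝ :=
  Matrix.fromRows (dataMatrix (delayed u h₂) 0 T)
    (Matrix.fromRows (dataMatrix (delayed x h₁) 0 T) (dataMatrix x 0 T))

/-- The signals `x`, `u` satisfy the system equation at time `k`, where the state delay is `h₁`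
and the input delay is `h₂`. -/
def SystemEqAt {n m : ℕ} (A₀ A₁ : Matrix (Fin n) (Fin n) ℝ) (B : Matrix (Fin n) (Fin m) ℝ)
    (x : ℤ → Fin n → ℝ) (u : ℤ → Fin m → ℝ) (h₁ h₂ k : ℕ) : Prop :=
  x ((k : ℤ) + 1) = A₀ *ᵥ x (k : ℤ) + A₁ *ᵥ x ((k : ℤ) - (h₁ : ℤ)) + B *ᵥ u ((k : ℤ) - (h₂ : ℤ))

/-- `x`, `u` is a trajectory of the system with time-varying delays `h₁ k`, `h₂ k` in closed loop
with `u(k) = K x(k)`.  The initial states `x j`, `-hbar ≤ j ≤ 0`, are arbitrary.  The past inputs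
`u j`, `-hbar ≤ j ≤ 0`, may be zero (the feedback is not yet in operation), and they may also be
given by the feedback law (so that the state alone obeys
`x(k+1) = A₀ x(k) + A₁ x(k - h₁ k) + B K x(k - h₂ k)` from time `0` on); time `0` may be counted
either as past or as present. -/
def IsClosedLoopTrajectory {n m : ℕ} (A₀ A₁ : Matrix (Fin n) (Fin n) ℝ)
    (B : Matrix (Fin n) (Fin m) ℝ) (K : Matrix (Fin m) (Fin n) ℝ) (hbar : ℕ) (h₁ h₂ : ℕ → ℕ)
    (x : ℤ → Fin n → ℝ) (u : ℤ → Fin m → ℝ) : Prop :=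
  (∀ k : ℕ, SystemEqAt A₀ A₁ B x u (h₁ k) (h₂ k) k) ∧
  (∀ k : ℤ, 0 < k → u k = K *ᵥ x k) ∧
  (∀ j : ℤ, -(hbar : ℤ) ≤ j → j ≤ 0 → u j = 0 ∨ u j = K *ᵥ x j)

/-- Exponential stability of the origin of the closed loop for all time-varying delays with values
in `[0, hbar]`: `‖x(k)‖ ≤ C ρ^k max_{-hbar ≤ j ≤ 0} ‖x(j)‖`, with `C` and `ρ < 1` that depend
neither on the delays nor on the trajectory.  (The maximum is expressed through its upper
bounds `M`.) -/
def ClosedLoopExpStable {n m : ℕ} (A₀ A₁ : Matrix (Fin n) (Fin n) ℝ)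
    (B : Matrix (Fin n) (Fin m) ℝ) (K : Matrix (Fin m) (Fin n) ℝ) (hbar : ℕ) : Prop :=
  ∃ C ρ : ℝ, 0 < C ∧ 0 < ρ ∧ ρ < 1 ∧
    ∀ h₁ h₂ : ℕ → ℕ, (∀ k, h₁ k ≤ hbar) → (∀ k, h₂ k ≤ hbar) →
      ∀ (x : ℤ → Fin n → ℝ) (u : ℤ → Fin m → ℝ),
        IsClosedLoopTrajectory A₀ A₁ B K hbar h₁ h₂ x u →
        ∀ M : ℝ, (∀ j : ℤ, -(hbar : ℤ) ≤ j → j ≤ 0 → euclNorm (x j) ≤ M) →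
          ∀ k : ℕ, euclNorm (x (k : ℤ)) ≤ C * ρ ^ k * M

/-- The symmetric `5n × 5n` block matrix of the linear matrix inequality.  Here `X₀`, `X₁` stand
for the data matrices `X_{0}`, `X_{1}`; `h` is the delay bound and `ε` the tuning parameter. -/
def lmiMatrix {n T : ℕ} (X₀ X₁ : Matrix (Fin n) (Fin T) ℝ) (h ε : ℝ)
    (P S R₁ R₂ S₁ S₂ : Matrix (Fin n) (Fin n) ℝ) (Q₁ Q₂ Q₃ : Matrix (Fin T) (Fin n) ℝ) :
    Matrix (Fin 5 × Fin n) (Fin 5 × Fin n) ℝ :=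
  let Φ₁₁ := P - S + (1 - h ^ 2) • (R₁ + R₂) - X₁ * Q₃ - (X₁ * Q₃)ᵀ
  let Φ₁₂ := -R₁ + S₁ - X₁ * Q₂
  let Φ₁₃ := -R₂ + S₂ - X₁ * Q₁
  let Φ₁₄ := -S₁ - S₂
  let Φ₁₅ := h ^ 2 • (R₁ + R₂) + X₀ * Q₃ - ε • (X₁ * Q₃)ᵀ
  let Φ₂₂ := (2 : ℝ) • R₁ - S₁ - S₁ᵀ
  let Φ₂₄ := -R₁ + S₁
  let Φ₂₅ := -(ε • (X₁ * Q₂)ᵀ)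
  let Φ₃₃ := (2 : ℝ) • R₂ - S₂ - S₂ᵀ
  let Φ₃₄ := -R₂ + S₂
  let Φ₃₅ := -(ε • (X₁ * Q₁)ᵀ)
  let Φ₄₄ := R₁ + R₂ + S
  let Φ₅₅ := -P - h ^ 2 • (R₁ + R₂) + ε • (X₀ * Q₃ + Q₃ᵀ * X₀ᵀ)
  Matrix.comp (Fin 5) (Fin 5) (Fin n) (Fin n) ℝ
    !![Φ₁₁,  Φ₁₂,  Φ₁₃,  Φ₁₄,  Φ₁₅;
       Φ₁₂ᵀ, Φ₂₂,  0,    Φ₂₄,  Φ₂₅;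
       Φ₁₃ᵀ, 0,    Φ₃₃,  Φ₃₄,  Φ₃₅;
       Φ₁₄ᵀ, Φ₂₄ᵀ, Φ₃₄ᵀ, Φ₄₄,  0;
       Φ₁₅ᵀ, Φ₂₅ᵀ, Φ₃₅ᵀ, 0,    Φ₅₅]

/-! Put `Y = X₀ * Q₃` and `z = Y⁻¹ x`. The data obey `X₁ = A₀ X₀ + A₁ Xh + B U`, so the equality
constraints turn `X₁ Q₃`, `X₁ Q₂`, `X₁ Q₁` into `A₀ Y`, `A₁ Y`, `B K Y`: the unknown closed loop
reads `Y z(k+1) = X₁Q₃ z(k) + X₁Q₂ z(k-h₁) + X₁Q₁ z(k-h₂)`, with known coefficients.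

Evaluated at `(z(k), z(k-h₁), z(k-h₂), z(k-hbar), z(k+1))`, the LMI form is a lower bound for the
decrease of a Lyapunov–Krasovskii functional, plus a multiple of the residual of this equation,
which vanishes along trajectories (`lmiMatrix_quadForm`, `reciprocally_convex_jensen`). Coercivity
gives strict dissipation (`exists_lyapunovKrasovskii_dissipation`), and summing it over one delay
window gives a geometric rate (`exists_decay_of_dissipation`).

Past inputs may violate the feedback law, so this argument starts at time `hbar + 1`;
`exists_growth_bound` covers the times before. -/

/-! ### Euclidean norm estimates and coercivity. -/

section EuclideanNorm

variable {n m : ℕ}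

theorem euclNorm_eq_norm_toLp (v : Fin n → ℝ) : euclNorm v = ‖WithLp.toLp 2 v‖ := by
  rw [euclNorm, EuclideanSpace.norm_eq]
  congr 1
  simp [dotProduct, sq]

theorem euclNorm_nonneg (v : Fin n → ℝ) : 0 ≤ euclNorm v := Real.sqrt_nonneg _

theorem dotProduct_self_nonneg_real {ι : Type*} [Fintype ι] (v : ι → ℝ) : 0 ≤ v ⬝ᵥ v :=
  Finset.sum_nonneg fun i _ => mul_self_nonneg (v i)

theorem euclNorm_sq (v : Fin n → ℝ) : euclNorm v ^ 2 = v ⬝ᵥ v :=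
  Real.sq_sqrt (dotProduct_self_nonneg_real v)

theorem euclNorm_zero : euclNorm (0 : Fin n → ℝ) = 0 := by
  simp [euclNorm]

theorem euclNorm_add_le (v w : Fin n → ℝ) : euclNorm (v + w) ≤ euclNorm v + euclNorm w := by
  simpa only [euclNorm_eq_norm_toLp, WithLp.toLp_add] using norm_add_le _ _

theorem dotProduct_le_euclNorm_mul (v w : Fin n → ℝ) :
    v ⬝ᵥ w ≤ euclNorm v * euclNorm w := by
  have h := real_inner_le_norm (WithLp.toLp 2 w) (WithLp.toLp 2 v)
  rw [EuclideanSpace.inner_toLp_toLp, star_trivial] at h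
  rw [euclNorm_eq_norm_toLp, euclNorm_eq_norm_toLp, mul_comm]
  exact h

open scoped Matrix.Norms.L2Operator in
theorem exists_euclNorm_mulVec_le (A : Matrix (Fin m) (Fin n) ℝ) :
    ∃ c : ℝ, 0 ≤ c ∧ ∀ v, euclNorm (A *ᵥ v) ≤ c * euclNorm v := by
  refine ⟨‖A‖, norm_nonneg _, fun v => ?_⟩
  rw [euclNorm_eq_norm_toLp, euclNorm_eq_norm_toLp]
  exact A.l2_opNorm_mulVec (WithLp.toLp 2 v)

theorem exists_quadForm_le (A : Matrix (Fin n) (Fin n) ℝ) :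
    ∃ c : ℝ, 0 ≤ c ∧ ∀ v, v ⬝ᵥ A *ᵥ v ≤ c * euclNorm v ^ 2 := by
  obtain ⟨c, hc, h⟩ := exists_euclNorm_mulVec_le A
  refine ⟨c, hc, fun v => (dotProduct_le_euclNorm_mul _ _).trans ?_⟩
  nlinarith [mul_le_mul_of_nonneg_left (h v) (euclNorm_nonneg v)]

/-- The quadratic form of a positive definite matrix is coercive. -/
theorem Matrix.PosDef.exists_pos_mul_le {ι : Type*} [Fintype ι] {M : Matrix ι ι ℝ}
    (hM : M.PosDef) : ∃ c : ℝ, 0 < c ∧ ∀ v, c * (v ⬝ᵥ v) ≤ v ⬝ᵥ M *ᵥ v := by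
  classical
  rcases isEmpty_or_nonempty ι with hι | hι
  · exact ⟨1, one_pos, fun v => by simp [dotProduct]⟩
  have hcont : Continuous fun w : EuclideanSpace ℝ ι => w.ofLp ⬝ᵥ M *ᵥ w.ofLp := by
    simp only [dotProduct, Matrix.mulVec]
    fun_prop
  obtain ⟨w, hw, hmin⟩ := (isCompact_sphere (0 : EuclideanSpace ℝ ι) 1).exists_isMinOn
    (NormedSpace.sphere_nonempty.2 zero_le_one) hcont.continuousOn
  have hw0 : w.ofLp ≠ 0 := by
    intro h
    have : w = 0 := by ext i; simp [h]
    simp [this] at hw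
  refine ⟨w.ofLp ⬝ᵥ M *ᵥ w.ofLp, by simpa using hM.dotProduct_mulVec_pos hw0, fun v => ?_⟩
  rcases eq_or_ne v 0 with rfl | hv
  · simp
  set e : EuclideanSpace ℝ ι := WithLp.toLp 2 v with he
  have he0 : e ≠ 0 := by
    intro h
    exact hv (by simpa [he] using congrArg WithLp.ofLp h)
  have hpos : 0 < ‖e‖ := norm_pos_iff.2 he0
  have hsq : v ⬝ᵥ v = ‖e‖ ^ 2 := by
    rw [EuclideanSpace.real_norm_sq_eq]
    simp [he, dotProduct, sq]
  have h1 := hmin (show ‖e‖⁻¹ • e ∈ Metric.sphere (0 : EuclideanSpace ℝ ι) 1 by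
    simp [norm_smul, hpos.ne'])
  simp only [Set.mem_ofPred_eq, WithLp.ofLp_smul, Matrix.mulVec_smul, smul_dotProduct,
    dotProduct_smul, smul_eq_mul] at h1
  rw [hsq]
  calc _ ≤ (‖e‖⁻¹ * (‖e‖⁻¹ * (v ⬝ᵥ M *ᵥ v))) * ‖e‖ ^ 2 := by gcongr
    _ = _ := by field_simp

end EuclideanNorm

/-! ### Quadratic forms: Jensen-type bounds and expansion of the LMI. -/

section QuadraticForms

variable {n : ℕ}

theorem dotProduct_transpose_mulVec' {m : ℕ} (A : Matrix (Fin n) (Fin m) ℝ) (v : Fin m → ℝ)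
    (w : Fin n → ℝ) : v ⬝ᵥ Aᵀ *ᵥ w = w ⬝ᵥ A *ᵥ v := by
  rw [Matrix.mulVec_transpose, dotProduct_comm, ← Matrix.dotProduct_mulVec]

theorem Matrix.PosDef.dotProduct_mulVec_comm {R : Matrix (Fin n) (Fin n) ℝ} (hR : R.PosDef)
    (v w : Fin n → ℝ) : v ⬝ᵥ R *ᵥ w = w ⬝ᵥ R *ᵥ v := by
  have : Rᵀ = R := by simpa using hR.isHermitian.eq
  conv_lhs => rw [← this]
  exact dotProduct_transpose_mulVec' R v w

/-- Test the block matrix on `(v, -w)`. -/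
theorem Matrix.PosSemidef.two_mul_dotProduct_le {R S : Matrix (Fin n) (Fin n) ℝ}
    (h : (Matrix.fromBlocks R S Sᵀ R).PosSemidef) (v w : Fin n → ℝ) :
    2 * (v ⬝ᵥ S *ᵥ w) ≤ v ⬝ᵥ R *ᵥ v + w ⬝ᵥ R *ᵥ w := by
  have h1 := h.dotProduct_mulVec_nonneg (Sum.elim v (-w))
  simp only [star_trivial, Matrix.fromBlocks_mulVec, sumElim_dotProduct_sumElim,
    Sum.elim_comp_inl, Sum.elim_comp_inr, dotProduct_add, Matrix.mulVec_neg, dotProduct_neg,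
    neg_dotProduct, dotProduct_transpose_mulVec'] at h1
  linarith

theorem Matrix.PosDef.two_mul_dotProduct_le {R : Matrix (Fin n) (Fin n) ℝ} (hR : R.PosDef)
    (v w : Fin n → ℝ) : 2 * (v ⬝ᵥ R *ᵥ w) ≤ v ⬝ᵥ R *ᵥ v + w ⬝ᵥ R *ᵥ w := by
  have h1 := hR.posSemidef.dotProduct_mulVec_nonneg (v - w)
  simp only [star_trivial, Matrix.mulVec_sub, sub_dotProduct, dotProduct_sub] at h1
  linarith [hR.dotProduct_mulVec_comm v w]

theorem two_mul_sum_dotProduct_sum_le {α β : Type*} (s : Finset α) (t : Finset β)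
    (f : α → Fin n → ℝ) (g : β → Fin n → ℝ) (M R : Matrix (Fin n) (Fin n) ℝ)
    (h : ∀ v w, 2 * (v ⬝ᵥ M *ᵥ w) ≤ v ⬝ᵥ R *ᵥ v + w ⬝ᵥ R *ᵥ w) :
    2 * ((∑ i ∈ s, f i) ⬝ᵥ M *ᵥ (∑ j ∈ t, g j)) ≤
      t.card * ∑ i ∈ s, f i ⬝ᵥ R *ᵥ f i + s.card * ∑ j ∈ t, g j ⬝ᵥ R *ᵥ g j := by
  calc 2 * ((∑ i ∈ s, f i) ⬝ᵥ M *ᵥ (∑ j ∈ t, g j))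
      = ∑ i ∈ s, ∑ j ∈ t, 2 * (f i ⬝ᵥ M *ᵥ g j) := by
        simp only [Matrix.mulVec_sum, sum_dotProduct, dotProduct_sum, Finset.mul_sum]
        rw [Finset.sum_comm]
    _ ≤ ∑ i ∈ s, ∑ j ∈ t, (f i ⬝ᵥ R *ᵥ f i + g j ⬝ᵥ R *ᵥ g j) :=
        Finset.sum_le_sum fun i _ => Finset.sum_le_sum fun j _ => h _ _
    _ = _ := by
        simp only [Finset.sum_add_distrib, Finset.sum_const, nsmul_eq_mul, Finset.mul_sum]

/-- Jensen's inequality combined with the reciprocally convex combination inequality. -/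
theorem reciprocally_convex_jensen {R S : Matrix (Fin n) (Fin n) ℝ} (hR : R.PosDef)
    (hS : (Matrix.fromBlocks R S Sᵀ R).PosSemidef) (z : ℕ → Fin n → ℝ) {a b c : ℕ}
    (hab : a ≤ b) (hbc : b ≤ c) :
    (z c - z b) ⬝ᵥ R *ᵥ (z c - z b) + 2 * ((z c - z b) ⬝ᵥ S *ᵥ (z b - z a))
      + (z b - z a) ⬝ᵥ R *ᵥ (z b - z a) ≤
    ((c : ℝ) - a) * ∑ i ∈ Finset.Ico a c, (z (i + 1) - z i) ⬝ᵥ R *ᵥ (z (i + 1) - z i) := by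
  -- Pairwise bounds are summed over increments, without dividing by interval lengths, so empty
  -- intervals (extreme delays) need no special case. The weights `c - b` and `b - a` add up to `c -
  -- a` on each subinterval.
  have key := fun s t => two_mul_sum_dotProduct_sum_le s t (fun i => z (i + 1) - z i)
    (fun i => z (i + 1) - z i)
  have h1 := key (Finset.Ico b c) (Finset.Ico b c) R R hR.two_mul_dotProduct_le
  have h2 := key (Finset.Ico b c) (Finset.Ico a b) S R hS.two_mul_dotProduct_le
  have h3 := key (Finset.Ico a b) (Finset.Ico a b) R R hR.two_mul_dotProduct_le
  simp only [Finset.sum_Ico_sub _ hab, Finset.sum_Ico_sub _ hbc, Nat.card_Ico,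
    Nat.cast_sub hab, Nat.cast_sub hbc] at h1 h2 h3
  rw [← Finset.sum_Ico_consecutive _ hab hbc]
  linarith

theorem comp_quadForm {ι : Type*} [Fintype ι] (M : Matrix ι ι (Matrix (Fin n) (Fin n) ℝ))
    (w : ι → Fin n → ℝ) :
    (fun p : ι × Fin n => w p.1 p.2) ⬝ᵥ
        Matrix.comp ι ι (Fin n) (Fin n) ℝ M *ᵥ (fun p : ι × Fin n => w p.1 p.2)
      = ∑ i, ∑ j, w i ⬝ᵥ M i j *ᵥ w j := by
  simp only [dotProduct, Matrix.mulVec, Matrix.comp_apply, Fintype.sum_prod_type, Finset.mul_sum]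
  exact Finset.sum_congr rfl fun i _ => Finset.sum_comm

/-- Separates the three roles of the LMI: the change of the functional without its sum over past
increments, the two Jensen terms bounding that sum, and the equation residual tested against `z + ε
zp`. -/
theorem lmiMatrix_quadForm {T : ℕ} (X₀ X₁ : Matrix (Fin n) (Fin T) ℝ) (h ε : ℝ)
    (P S R₁ R₂ S₁ S₂ : Matrix (Fin n) (Fin n) ℝ) (Q₁ Q₂ Q₃ : Matrix (Fin T) (Fin n) ℝ)
    (hR₁ : R₁.PosDef) (hR₂ : R₂.PosDef) (z z₁ z₂ zh zp : Fin n → ℝ) :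
    (fun p : Fin 5 × Fin n => ![z, z₁, z₂, zh, zp] p.1 p.2) ⬝ᵥ
        lmiMatrix X₀ X₁ h ε P S R₁ R₂ S₁ S₂ Q₁ Q₂ Q₃ *ᵥ
          (fun p : Fin 5 × Fin n => ![z, z₁, z₂, zh, zp] p.1 p.2)
      = z ⬝ᵥ P *ᵥ z - zp ⬝ᵥ P *ᵥ zp - z ⬝ᵥ S *ᵥ z + zh ⬝ᵥ S *ᵥ zh
        - h ^ 2 * ((zp - z) ⬝ᵥ R₁ *ᵥ (zp - z)) - h ^ 2 * ((zp - z) ⬝ᵥ R₂ *ᵥ (zp - z))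
        + ((z - z₁) ⬝ᵥ R₁ *ᵥ (z - z₁) + 2 * ((z - z₁) ⬝ᵥ S₁ *ᵥ (z₁ - zh))
            + (z₁ - zh) ⬝ᵥ R₁ *ᵥ (z₁ - zh))
        + ((z - z₂) ⬝ᵥ R₂ *ᵥ (z - z₂) + 2 * ((z - z₂) ⬝ᵥ S₂ *ᵥ (z₂ - zh))
            + (z₂ - zh) ⬝ᵥ R₂ *ᵥ (z₂ - zh))
        + 2 * ((z + ε • zp) ⬝ᵥ ((X₀ * Q₃) *ᵥ zp - (X₁ * Q₃) *ᵥ z - (X₁ * Q₂) *ᵥ z₁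
            - (X₁ * Q₁) *ᵥ z₂)) := by
  have hX : Q₃ᵀ * X₀ᵀ = (X₀ * Q₃)ᵀ := (Matrix.transpose_mul _ _).symm
  simp only [lmiMatrix, comp_quadForm, hX]
  generalize X₀ * Q₃ = Y
  generalize X₁ * Q₁ = M₁
  generalize X₁ * Q₂ = M₂
  generalize X₁ * Q₃ = M₃
  have e : ∀ {R : Matrix (Fin n) (Fin n) ℝ}, R.PosDef → Rᵀ = R := fun hR => by
    simpa using hR.isHermitian.eq
  simp only [Fin.sum_univ_five, Matrix.of_apply, Matrix.cons_val, Matrix.cons_val_zero,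
    Matrix.cons_val_one]
  simp only [Matrix.transpose_add, Matrix.transpose_sub, Matrix.transpose_neg,
    Matrix.transpose_smul, Matrix.transpose_transpose, e hR₁, e hR₂,
    Matrix.add_mulVec, Matrix.sub_mulVec, Matrix.neg_mulVec, Matrix.smul_mulVec,
    Matrix.zero_mulVec, dotProduct_zero,
    Matrix.mulVec_sub,
    dotProduct_add, dotProduct_sub, dotProduct_neg, dotProduct_smul,
    add_dotProduct, sub_dotProduct, smul_dotProduct, smul_eq_mul,
    dotProduct_transpose_mulVec']
  rw [hR₁.dotProduct_mulVec_comm zp z, hR₁.dotProduct_mulVec_comm z₁ z,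
    hR₁.dotProduct_mulVec_comm zh z₁, hR₂.dotProduct_mulVec_comm zp z,
    hR₂.dotProduct_mulVec_comm z₂ z, hR₂.dotProduct_mulVec_comm zh z₂]
  ring

end QuadraticForms

/-! ### Geometric decay of scalar sequences. -/

section Decay

/-- Take `ρ = q ^ (1 / (2N))`. The exponent `2 * k` leaves `ρ ^ k` after the square root that passes
from `V` to a norm; `q⁻¹` absorbs the first `N` indices. -/
theorem exists_geometric_decay {N : ℕ} (hN : 0 < N) {q : ℝ} (hq0 : 0 < q) (hq1 : q < 1) :
    ∃ ρ : ℝ, 0 < ρ ∧ ρ < 1 ∧ ∀ V : ℕ → ℝ, (∀ k, 0 ≤ V k) → Antitone V →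
      (∀ k, V (k + N) ≤ q * V k) → ∀ k, V k ≤ q⁻¹ * ρ ^ (2 * k) * V 0 := by
  have hρ : (q ^ ((2 * N : ℕ) : ℝ)⁻¹) ^ (2 * N) = q :=
    Real.rpow_inv_natCast_pow hq0.le (by omega)
  have hexp : 0 < ((2 * N : ℕ) : ℝ)⁻¹ := by positivity
  generalize hr : q ^ ((2 * N : ℕ) : ℝ)⁻¹ = ρ at hρ
  have hρ0 : 0 < ρ := hr ▸ Real.rpow_pos_of_pos hq0 _
  have hρ1 : ρ < 1 := hr ▸ Real.rpow_lt_one hq0.le hq1 hexp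
  refine ⟨ρ, hρ0, hρ1, fun V hV hanti hstep k => ?_⟩
  induction k using Nat.strong_induction_on with
  | _ k ih =>
    rcases lt_or_ge k N with hk | hk
    · have h1 : 1 ≤ q⁻¹ * ρ ^ (2 * k) := by
        rw [inv_mul_eq_div, one_le_div hq0]
        calc q = ρ ^ (2 * N) := hρ.symm
          _ ≤ ρ ^ (2 * k) := pow_le_pow_of_le_one hρ0.le hρ1.le (by omega)
      calc V k ≤ 1 * V 0 := by simpa using hanti (Nat.zero_le k)
        _ ≤ _ := by gcongr; exact hV 0
    · obtain ⟨j, rfl⟩ := Nat.exists_eq_add_of_le' hk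
      calc V (j + N) ≤ q * V j := hstep j
        _ ≤ q * (q⁻¹ * ρ ^ (2 * j) * V 0) := by gcongr; exact ih j (by omega)
        _ = q⁻¹ * ρ ^ (2 * (j + N)) * V 0 := by
          rw [mul_add, pow_add, hρ]; ring

/-- Over `h + 1` steps the total loss is `c` times a full window sum of `s`, which itself is at
least `V / b` at the end. Hence `(1 + c / b) V(k+h+1) ≤ V(k)`. -/
theorem exists_decay_of_dissipation (h : ℕ) {b c : ℝ} (hb : 0 < b) (hc : 0 < c) :
    ∃ C ρ : ℝ, 0 < C ∧ 0 < ρ ∧ ρ < 1 ∧ ∀ V s : ℕ → ℝ, (∀ k, 0 ≤ V k) → (∀ k, 0 ≤ s k) →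
      (∀ k, V (k + 1) ≤ V k - c * s (k + h)) →
      (∀ k, V k ≤ b * ∑ i ∈ Finset.range (h + 1), s (k + i)) →
      ∀ k, V k ≤ C * ρ ^ (2 * k) * V 0 := by
  have hq1 : (1 + c / b)⁻¹ < 1 := inv_lt_one_of_one_lt₀ (by linarith [div_pos hc hb])
  obtain ⟨ρ, hρ0, hρ1, hdec⟩ := exists_geometric_decay h.succ_pos
    (inv_pos.2 (by positivity : 0 < 1 + c / b)) hq1
  refine ⟨_, ρ, by positivity, hρ0, hρ1, fun V s hV hs hstep hup => hdec V hV ?_ ?_⟩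
  · exact antitone_nat_of_succ_le fun k => by nlinarith [hstep k, hs (k + h)]
  · have hanti : Antitone V :=
      antitone_nat_of_succ_le fun k => by nlinarith [hstep k, hs (k + h)]
    intro k
    have hsum : ∀ j, V (k + j) ≤ V k - c * ∑ i ∈ Finset.range j, s (k + h + i) := by
      intro j
      induction j with
      | zero => simp
      | succ j ih =>
        have := hstep (k + j)
        rw [Finset.sum_range_succ, ← add_assoc, show k + h + j = k + j + h by ring]
        linarith
    have h1 := hsum (h + 1)
    -- Stepping back to `k + h` by monotonicity makes the window of the upper bound coincide with
    -- the one in `h1`.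
    have h2 := (hanti (show k + h ≤ k + (h + 1) by omega)).trans (hup (k + h))
    rw [inv_mul_eq_div, le_div_iff₀ (by positivity)]
    have h3 : V (k + (h + 1)) * (c / b) ≤
        c * ∑ i ∈ Finset.range (h + 1), s (k + h + i) := by
      rw [mul_div_assoc', div_le_iff₀ hb]
      nlinarith [mul_le_mul_of_nonneg_left h2 hc.le]
    rw [Nat.succ_eq_add_one]
    linarith

end Decay

/-! ### The Lyapunov–Krasovskii functional and its dissipation. -/

section LyapunovKrasovskii

variable {n : ℕ}

/-- The Lyapunov–Krasovskii functional
`zᵀ P z + ∑ zᵀ S z + h ∑ ∑ ηᵀ R η` on the window `k, …, k + h`, where `η` is the increment of `z`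
and the double sum is written as a weighted simple sum. -/
def lyapunovKrasovskii (h : ℕ) (P S R : Matrix (Fin n) (Fin n) ℝ) (z : ℕ → Fin n → ℝ) (k : ℕ) :
    ℝ :=
  z (k + h) ⬝ᵥ P *ᵥ z (k + h) + ∑ i ∈ Finset.range h, z (k + i) ⬝ᵥ S *ᵥ z (k + i) +
    h * ∑ i ∈ Finset.range h,
      ((i : ℝ) + 1) * ((z (k + i + 1) - z (k + i)) ⬝ᵥ R *ᵥ (z (k + i + 1) - z (k + i)))

theorem sum_window_succ (f : ℕ → ℝ) (k h : ℕ) :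
    ∑ i ∈ Finset.range h, f (k + 1 + i) = ∑ i ∈ Finset.range h, f (k + i) + f (k + h) - f k := by
  have h1 := Finset.sum_range_succ (fun i => f (k + i)) h
  rw [Finset.sum_range_succ'] at h1
  simp only [add_zero] at h1
  simp only [add_right_comm k 1, ← add_assoc] at h1 ⊢
  linarith

theorem weighted_sum_window_succ (f : ℕ → ℝ) (k h : ℕ) :
    ∑ i ∈ Finset.range h, ((i : ℝ) + 1) * f (k + 1 + i) =
      ∑ i ∈ Finset.range h, ((i : ℝ) + 1) * f (k + i) + h * f (k + h)
        - ∑ i ∈ Finset.range h, f (k + i) := by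
  have h1 := Finset.sum_range_succ (fun i : ℕ => (i : ℝ) * f (k + i)) h
  rw [Finset.sum_range_succ'] at h1
  simp only [Nat.cast_zero, zero_mul, add_zero, Nat.cast_add, Nat.cast_one, ← add_assoc] at h1
  simp only [add_mul, one_mul, Finset.sum_add_distrib, add_right_comm k 1] at h1 ⊢
  linarith

theorem lyapunovKrasovskii_succ (h : ℕ) (P S R : Matrix (Fin n) (Fin n) ℝ)
    (z : ℕ → Fin n → ℝ) (k : ℕ) :
    lyapunovKrasovskii h P S R z (k + 1) = lyapunovKrasovskii h P S R z k
      + z (k + h + 1) ⬝ᵥ P *ᵥ z (k + h + 1) - z (k + h) ⬝ᵥ P *ᵥ z (k + h)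
      + z (k + h) ⬝ᵥ S *ᵥ z (k + h) - z k ⬝ᵥ S *ᵥ z k
      + (h : ℝ) ^ 2 * ((z (k + h + 1) - z (k + h)) ⬝ᵥ R *ᵥ (z (k + h + 1) - z (k + h)))
      - h * ∑ i ∈ Finset.Ico k (k + h), (z (i + 1) - z i) ⬝ᵥ R *ᵥ (z (i + 1) - z i) := by
  have h1 := sum_window_succ (fun i => z i ⬝ᵥ S *ᵥ z i) k h
  have h2 := weighted_sum_window_succ (fun i => (z (i + 1) - z i) ⬝ᵥ R *ᵥ (z (i + 1) - z i)) k h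
  rw [Finset.sum_Ico_eq_sum_range, Nat.add_sub_cancel_left]
  simp only [lyapunovKrasovskii, h1, h2, add_right_comm k 1 h]
  ring

theorem le_lyapunovKrasovskii (h : ℕ) {P S R : Matrix (Fin n) (Fin n) ℝ} (hS : S.PosDef)
    (hR : R.PosDef) (z : ℕ → Fin n → ℝ) (k : ℕ) :
    z (k + h) ⬝ᵥ P *ᵥ z (k + h) ≤ lyapunovKrasovskii h P S R z k := by
  have hq : ∀ {M : Matrix (Fin n) (Fin n) ℝ}, M.PosDef → ∀ v, 0 ≤ v ⬝ᵥ M *ᵥ v :=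
    fun hM v => by simpa using hM.posSemidef.dotProduct_mulVec_nonneg v
  have h1 : 0 ≤ ∑ i ∈ Finset.range h, z (k + i) ⬝ᵥ S *ᵥ z (k + i) :=
    Finset.sum_nonneg fun i _ => hq hS _
  have h2 : 0 ≤ h * ∑ i ∈ Finset.range h,
      ((i : ℝ) + 1) * ((z (k + i + 1) - z (k + i)) ⬝ᵥ R *ᵥ (z (k + i + 1) - z (k + i))) :=
    mul_nonneg h.cast_nonneg (Finset.sum_nonneg fun i _ => mul_nonneg (by positivity) (hq hR _))
  rw [lyapunovKrasovskii]
  linarith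

theorem euclNorm_sub_sq_le (v w : Fin n → ℝ) :
    euclNorm (v - w) ^ 2 ≤ 2 * euclNorm v ^ 2 + 2 * euclNorm w ^ 2 := by
  have h := dotProduct_self_nonneg_real (v + w)
  simp only [euclNorm_sq, sub_dotProduct, dotProduct_sub, add_dotProduct, dotProduct_add] at h ⊢
  linarith

theorem exists_lyapunovKrasovskii_le (h : ℕ) (P S R : Matrix (Fin n) (Fin n) ℝ) :
    ∃ b : ℝ, 0 < b ∧ ∀ (z : ℕ → Fin n → ℝ) (k : ℕ), lyapunovKrasovskii h P S R z k ≤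
      b * ∑ i ∈ Finset.range (h + 1), euclNorm (z (k + i)) ^ 2 := by
  obtain ⟨p, hp, hP⟩ := exists_quadForm_le P
  obtain ⟨s, hs, hS⟩ := exists_quadForm_le S
  obtain ⟨r, hr, hR⟩ := exists_quadForm_le R
  -- In the increment term, one `h` is the prefactor, one counts summands, one bounds the weight `i
  -- + 1`, and `4 * r` comes from `euclNorm_sub_sq_le`. The final `1` only ensures positivity.
  refine ⟨p + h * s + h * (h * (h * (4 * r))) + 1, by positivity, fun z k => ?_⟩
  set E := ∑ i ∈ Finset.range (h + 1), euclNorm (z (k + i)) ^ 2 with hE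
  have hle : ∀ i ≤ h, euclNorm (z (k + i)) ^ 2 ≤ E := fun i hi =>
    Finset.single_le_sum (f := fun i => euclNorm (z (k + i)) ^ 2) (fun i _ => sq_nonneg _)
      (Finset.mem_range.2 (by omega))
  have hE0 : 0 ≤ E := Finset.sum_nonneg fun i _ => sq_nonneg _
  have h1 : z (k + h) ⬝ᵥ P *ᵥ z (k + h) ≤ p * E :=
    (hP _).trans (mul_le_mul_of_nonneg_left (hle h le_rfl) hp)
  have h2 : ∑ i ∈ Finset.range h, z (k + i) ⬝ᵥ S *ᵥ z (k + i) ≤ h * (s * E) := by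
    refine (Finset.sum_le_card_nsmul _ _ (s * E) fun i hi => ?_).trans (by simp)
    exact (hS _).trans (mul_le_mul_of_nonneg_left (hle i (Finset.mem_range.1 hi).le) hs)
  have h3 : ∑ i ∈ Finset.range h,
      ((i : ℝ) + 1) * ((z (k + i + 1) - z (k + i)) ⬝ᵥ R *ᵥ (z (k + i + 1) - z (k + i)))
      ≤ h * (h * (4 * r * E)) := by
    refine (Finset.sum_le_card_nsmul _ _ (h * (4 * r * E)) fun i hi => ?_).trans (by simp)
    have hi' := Finset.mem_range.1 hi
    have h4 : (z (k + i + 1) - z (k + i)) ⬝ᵥ R *ᵥ (z (k + i + 1) - z (k + i)) ≤ 4 * r * E := by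
      refine (hR _).trans ?_
      have h5 := euclNorm_sub_sq_le (z (k + i + 1)) (z (k + i))
      have h6 := hle (i + 1) hi'
      have h7 := hle i hi'.le
      rw [← add_assoc] at h6
      nlinarith [mul_le_mul_of_nonneg_left (h5.trans (by linarith : _ ≤ 4 * E)) hr]
    have h8 : (i : ℝ) + 1 ≤ h := by exact_mod_cast hi'
    exact (mul_le_mul_of_nonneg_left h4 (by positivity)).trans
      (mul_le_mul_of_nonneg_right h8 (by positivity))
  have h9 := mul_le_mul_of_nonneg_left h3 (Nat.cast_nonneg (α := ℝ) h)
  rw [lyapunovKrasovskii]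
  nlinarith

variable {T : ℕ} {X₀ X₁ : Matrix (Fin n) (Fin T) ℝ} {h : ℕ} {ε : ℝ}
  {P S R₁ R₂ S₁ S₂ : Matrix (Fin n) (Fin n) ℝ} {Q₁ Q₂ Q₃ : Matrix (Fin T) (Fin n) ℝ}

/-- On `(0, 0, 0, 0, v)` with `v` in the kernel of `X₀ * Q₃`, the `ε` term vanishes and the form is
nonpositive, so `v = 0`. -/
theorem isUnit_of_lmiMatrix_posDef (hP : P.PosDef) (hR₁ : R₁.PosDef) (hR₂ : R₂.PosDef)
    (hΦ : (lmiMatrix X₀ X₁ (h : ℝ) ε P S R₁ R₂ S₁ S₂ Q₁ Q₂ Q₃).PosDef) :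
    IsUnit (X₀ * Q₃) := by
  rw [← Matrix.mulVec_injective_iff_isUnit, ← Matrix.coe_mulVecLin, ← LinearMap.ker_eq_bot,
    LinearMap.ker_eq_bot']
  intro v hv
  rw [Matrix.mulVecLin_apply] at hv
  by_contra hv0
  have hne : (fun p : Fin 5 × Fin n => ![0, 0, 0, 0, v] p.1 p.2) ≠ 0 := by
    intro h0
    exact hv0 (funext fun a => by simpa using congrFun h0 (4, a))
  have h1 := hΦ.dotProduct_mulVec_pos hne
  rw [star_trivial, lmiMatrix_quadForm X₀ X₁ h ε P S R₁ R₂ S₁ S₂ Q₁ Q₂ Q₃ hR₁ hR₂, hv] at h1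
  simp only [Matrix.mulVec_zero, dotProduct_zero, sub_zero, add_zero, zero_sub] at h1
  have hq : ∀ {M : Matrix (Fin n) (Fin n) ℝ}, M.PosDef → 0 ≤ v ⬝ᵥ M *ᵥ v :=
    fun hM => by simpa using hM.posSemidef.dotProduct_mulVec_nonneg v
  nlinarith [hq hP, mul_nonneg (sq_nonneg (h : ℝ)) (hq hR₁),
    mul_nonneg (sq_nonneg (h : ℝ)) (hq hR₂)]

/-- The window `k, …, k + h` ends at the present, so index `k + i` carries delay `h - i`. -/
theorem exists_lyapunovKrasovskii_dissipation (hR₁ : R₁.PosDef) (hR₂ : R₂.PosDef)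
    (hΦ : (lmiMatrix X₀ X₁ (h : ℝ) ε P S R₁ R₂ S₁ S₂ Q₁ Q₂ Q₃).PosDef)
    (hRS₁ : (Matrix.fromBlocks R₁ S₁ S₁ᵀ R₁).PosSemidef)
    (hRS₂ : (Matrix.fromBlocks R₂ S₂ S₂ᵀ R₂).PosSemidef) :
    ∃ c : ℝ, 0 < c ∧ ∀ (z : ℕ → Fin n → ℝ) (k i j : ℕ), i ≤ h → j ≤ h →
      (X₀ * Q₃) *ᵥ z (k + h + 1) = (X₁ * Q₃) *ᵥ z (k + h) + (X₁ * Q₂) *ᵥ z (k + i)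
        + (X₁ * Q₁) *ᵥ z (k + j) →
      lyapunovKrasovskii h P S (R₁ + R₂) z (k + 1) ≤
        lyapunovKrasovskii h P S (R₁ + R₂) z k - c * euclNorm (z (k + h)) ^ 2 := by
  obtain ⟨c, hc, hcoer⟩ := hΦ.exists_pos_mul_le
  refine ⟨c, hc, fun z k i j hi hj hdyn => ?_⟩
  have h1 := hcoer fun p : Fin 5 × Fin n =>
    ![z (k + h), z (k + i), z (k + j), z k, z (k + h + 1)] p.1 p.2
  rw [lmiMatrix_quadForm X₀ X₁ h ε P S R₁ R₂ S₁ S₂ Q₁ Q₂ Q₃ hR₁ hR₂, hdyn] at h1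
  have h0 : (X₁ * Q₃) *ᵥ z (k + h) + (X₁ * Q₂) *ᵥ z (k + i) + (X₁ * Q₁) *ᵥ z (k + j)
      - (X₁ * Q₃) *ᵥ z (k + h) - (X₁ * Q₂) *ᵥ z (k + i) - (X₁ * Q₁) *ᵥ z (k + j) = 0 := by abel
  rw [h0, dotProduct_zero, mul_zero, add_zero] at h1
  have h2 : euclNorm (z (k + h)) ^ 2 ≤
      (fun p : Fin 5 × Fin n => ![z (k + h), z (k + i), z (k + j), z k, z (k + h + 1)] p.1 p.2)
        ⬝ᵥ fun p => ![z (k + h), z (k + i), z (k + j), z k, z (k + h + 1)] p.1 p.2 := by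
    rw [euclNorm_sq, dotProduct, dotProduct, Fintype.sum_prod_type, Fin.sum_univ_succ]
    exact le_add_of_nonneg_right
      (Finset.sum_nonneg fun _ _ => Finset.sum_nonneg fun _ _ => mul_self_nonneg _)
  have h3 := reciprocally_convex_jensen hR₁ hRS₁ z (Nat.le_add_right k i)
    (Nat.add_le_add_left hi k)
  have h4 := reciprocally_convex_jensen hR₂ hRS₂ z (Nat.le_add_right k j)
    (Nat.add_le_add_left hj k)
  rw [Nat.cast_add, add_sub_cancel_left] at h3 h4
  rw [lyapunovKrasovskii_succ]
  simp only [Matrix.add_mulVec, dotProduct_add, Finset.sum_add_distrib]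
  nlinarith [mul_le_mul_of_nonneg_left h2 hc.le]

theorem exists_exponential_decay_of_lmi (hP : P.PosDef) (hS : S.PosDef) (hR₁ : R₁.PosDef)
    (hR₂ : R₂.PosDef)
    (hΦ : (lmiMatrix X₀ X₁ (h : ℝ) ε P S R₁ R₂ S₁ S₂ Q₁ Q₂ Q₃).PosDef)
    (hRS₁ : (Matrix.fromBlocks R₁ S₁ S₁ᵀ R₁).PosSemidef)
    (hRS₂ : (Matrix.fromBlocks R₂ S₂ S₂ᵀ R₂).PosSemidef) :
    ∃ C ρ : ℝ, 0 < C ∧ 0 < ρ ∧ ρ < 1 ∧ ∀ (z : ℕ → Fin n → ℝ) (i j : ℕ → ℕ),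
      (∀ k, i k ≤ h) → (∀ k, j k ≤ h) →
      (∀ k, (X₀ * Q₃) *ᵥ z (k + h + 1) = (X₁ * Q₃) *ᵥ z (k + h) + (X₁ * Q₂) *ᵥ z (k + i k)
        + (X₁ * Q₁) *ᵥ z (k + j k)) →
      ∀ M : ℝ, (∀ l ≤ h, euclNorm (z l) ≤ M) → ∀ k, euclNorm (z (k + h)) ≤ C * ρ ^ k * M := by
  obtain ⟨p, hp, hPcoer⟩ := hP.exists_pos_mul_le
  obtain ⟨b, hb, hup⟩ := exists_lyapunovKrasovskii_le h P S (R₁ + R₂)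
  obtain ⟨c, hc, hdiss⟩ := exists_lyapunovKrasovskii_dissipation hR₁ hR₂ hΦ hRS₁ hRS₂
  obtain ⟨C, ρ, hC, hρ0, hρ1, hdec⟩ := exists_decay_of_dissipation h hb hc
  have hD : 0 < C * (b * (h + 1)) / p := by positivity
  -- From `p ‖z(k+h)‖² ≤ V k ≤ C ρ^(2k) V 0` and `V 0 ≤ b (h + 1) M²`.
  refine ⟨√(C * (b * (h + 1)) / p), ρ, Real.sqrt_pos.2 hD, hρ0, hρ1,
    fun z i j hi hj hdyn M hM k => ?_⟩
  have hM0 : 0 ≤ M := (euclNorm_nonneg _).trans (hM 0 h.zero_le)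
  have hlow : ∀ k, p * euclNorm (z (k + h)) ^ 2 ≤ lyapunovKrasovskii h P S (R₁ + R₂) z k :=
    fun k => by
      rw [euclNorm_sq]
      exact (hPcoer _).trans (le_lyapunovKrasovskii h hS (hR₁.add hR₂) z k)
  have h1 := hdec (lyapunovKrasovskii h P S (R₁ + R₂) z) (fun k => euclNorm (z k) ^ 2)
    (fun k => le_trans (by positivity) (hlow k)) (fun k => sq_nonneg _)
    (fun k => hdiss z k (i k) (j k) (hi k) (hj k) (hdyn k)) (hup z) k
  have h2 : lyapunovKrasovskii h P S (R₁ + R₂) z 0 ≤ b * ((h + 1) * M ^ 2) := by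
    refine (hup z 0).trans (mul_le_mul_of_nonneg_left ?_ hb.le)
    refine (Finset.sum_le_card_nsmul _ _ (M ^ 2) fun l hl => ?_).trans (by simp)
    rw [zero_add]
    exact pow_le_pow_left₀ (euclNorm_nonneg _)
      (hM l (Nat.lt_succ_iff.1 (Finset.mem_range.1 hl))) 2
  refine (pow_le_pow_iff_left₀ (euclNorm_nonneg _) (by positivity) two_ne_zero).1 ?_
  rw [mul_pow, mul_pow, Real.sq_sqrt hD.le, div_mul_eq_mul_div, div_mul_eq_mul_div,
    le_div_iff₀ hp]
  calc euclNorm (z (k + h)) ^ 2 * p ≤ C * ρ ^ (2 * k) * lyapunovKrasovskii h P S (R₁ + R₂) z 0 := by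
        rw [mul_comm]; exact (hlow k).trans h1
    _ ≤ C * ρ ^ (2 * k) * (b * ((h + 1) * M ^ 2)) := by gcongr
    _ = _ := by rw [pow_mul']; ring

end LyapunovKrasovskii

/-! ### Data identity, initial transient and the main theorem. -/

section ClosedLoop

variable {n m : ℕ}

theorem dataMatrix_one_eq {A₀ A₁ : Matrix (Fin n) (Fin n) ℝ} {B : Matrix (Fin n) (Fin m) ℝ}
    {T d₁ d₂ : ℕ} {x : ℤ → Fin n → ℝ} {u : ℤ → Fin m → ℝ}
    (hdata : ∀ k : ℕ, k < T → SystemEqAt A₀ A₁ B x u d₁ d₂ k) :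
    dataMatrix x 1 T = A₀ * dataMatrix x 0 T + A₁ * dataMatrix (delayed x d₁) 0 T
      + B * dataMatrix (delayed u d₂) 0 T := by
  ext a t
  have h := congrFun (hdata t t.isLt) a
  rw [add_comm] at h
  simpa [dataMatrix, delayed, Matrix.mul_apply, Matrix.mulVec, dotProduct] using h

/-- Bounds the transient during which delayed inputs may still be past values. Whether an input is
zero or `K x`, its norm is at most `c` times that of the state, so one factor `G` per step suffices.
-/
theorem exists_growth_bound (A₀ A₁ : Matrix (Fin n) (Fin n) ℝ) (B : Matrix (Fin n) (Fin m) ℝ)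
    (K : Matrix (Fin m) (Fin n) ℝ) (hbar : ℕ) :
    ∃ G : ℝ, 1 ≤ G ∧ ∀ h₁ h₂ : ℕ → ℕ, (∀ k, h₁ k ≤ hbar) → (∀ k, h₂ k ≤ hbar) →
      ∀ (x : ℤ → Fin n → ℝ) (u : ℤ → Fin m → ℝ),
        IsClosedLoopTrajectory A₀ A₁ B K hbar h₁ h₂ x u →
        ∀ M : ℝ, (∀ j : ℤ, -(hbar : ℤ) ≤ j → j ≤ 0 → euclNorm (x j) ≤ M) →
          ∀ (k : ℕ) (j : ℤ), -(hbar : ℤ) ≤ j → j ≤ k → euclNorm (x j) ≤ G ^ k * M := by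
  obtain ⟨a₀, ha₀, hA₀⟩ := exists_euclNorm_mulVec_le A₀
  obtain ⟨a₁, ha₁, hA₁⟩ := exists_euclNorm_mulVec_le A₁
  obtain ⟨b, hb, hB⟩ := exists_euclNorm_mulVec_le B
  obtain ⟨c, hc, hK⟩ := exists_euclNorm_mulVec_le K
  have hG : 1 ≤ 1 + a₀ + a₁ + b * c := by nlinarith [mul_nonneg hb hc]
  refine ⟨1 + a₀ + a₁ + b * c, hG, fun h₁ h₂ hh₁ hh₂ x u ⟨hsys, hfb, hpast⟩ M hM k => ?_⟩
  have hM0 : 0 ≤ M := (euclNorm_nonneg _).trans (hM 0 (by omega) le_rfl)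
  have hu : ∀ j : ℤ, -(hbar : ℤ) ≤ j → euclNorm (u j) ≤ c * euclNorm (x j) := by
    intro j hj
    rcases lt_or_ge 0 j with h0 | h0
    · rw [hfb j h0]; exact hK _
    · rcases hpast j hj h0 with h | h
      · rw [h, euclNorm_zero]; exact mul_nonneg hc (euclNorm_nonneg _)
      · rw [h]; exact hK _
  induction k with
  | zero => simpa using hM
  | succ k ih =>
    intro j hj hjk
    have hGk : 0 ≤ (1 + a₀ + a₁ + b * c) ^ k * M := by positivity
    rcases lt_or_eq_of_le hjk with hlt | rfl
    · refine (ih j hj (by push_cast at hlt; omega)).trans ?_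
      rw [pow_succ, mul_right_comm]
      exact le_mul_of_one_le_right hGk hG
    · have i₁ := hh₁ k
      have i₂ := hh₂ k
      have e₀ := (hA₀ _).trans (mul_le_mul_of_nonneg_left (ih k (by omega) le_rfl) ha₀)
      have e₁ := (hA₁ _).trans
        (mul_le_mul_of_nonneg_left (ih (k - (h₁ k : ℤ)) (by omega) (by omega)) ha₁)
      have e₂ := (hB _).trans (mul_le_mul_of_nonneg_left
        ((hu (k - (h₂ k : ℤ)) (by omega)).trans
          (mul_le_mul_of_nonneg_left (ih (k - (h₂ k : ℤ)) (by omega) (by omega)) hc)) hb)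
      rw [Nat.cast_add, Nat.cast_one, hsys k]
      refine (euclNorm_add_le _ _).trans
        ((add_le_add (euclNorm_add_le _ _) le_rfl).trans ?_)
      rw [pow_succ]
      nlinarith

end ClosedLoop

theorem theorem1 {n m : ℕ}
    -- the (unknown) system and the delay bound
    (A₀ A₁ : Matrix (Fin n) (Fin n) ℝ) (B : Matrix (Fin n) (Fin m) ℝ)
    (hbar : ℕ) (hbar_pos : 0 < hbar)
    -- the recorded data, generated by the system with constant delays `d₁`, `d₂`
    (T : ℕ) (hT : hbar < T) (d₁ d₂ : ℕ) (hd₁ : d₁ ≤ hbar) (hd₂ : d₂ ≤ hbar)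
    (x : ℤ → Fin n → ℝ) (u : ℤ → Fin m → ℝ)
    (hdata : ∀ k : ℕ, k < T → SystemEqAt A₀ A₁ B x u d₁ d₂ k)
    (hrank : (dataW0 x u d₁ d₂ T).rank = m + 2 * n)
    -- the tuning parameter and the decision variables
    (ε : ℝ) (hε : 0 < ε)
    (P S R₁ R₂ S₁ S₂ : Matrix (Fin n) (Fin n) ℝ) (Q₁ Q₂ Q₃ : Matrix (Fin T) (Fin n) ℝ)
    (hP : P.PosDef) (hS : S.PosDef) (hR₁ : R₁.PosDef) (hR₂ : R₂.PosDef)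
    -- the linear matrix inequalities
    (hΦ : (lmiMatrix (dataMatrix x 0 T) (dataMatrix x 1 T) (hbar : ℝ) ε
      P S R₁ R₂ S₁ S₂ Q₁ Q₂ Q₃).PosDef)
    (hRS₁ : (Matrix.fromBlocks R₁ S₁ S₁ᵀ R₁).PosSemidef)
    (hRS₂ : (Matrix.fromBlocks R₂ S₂ S₂ᵀ R₂).PosSemidef)
    -- the equality constraints
    (hUQ₂ : dataMatrix (delayed u d₂) 0 T * Q₂ = 0)
    (hUQ₃ : dataMatrix (delayed u d₂) 0 T * Q₃ = 0)
    (hXhQ₁ : dataMatrix (delayed x d₁) 0 T * Q₁ = 0)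
    (hXhQ₃ : dataMatrix (delayed x d₁) 0 T * Q₃ = 0)
    (hXQ₁ : dataMatrix x 0 T * Q₁ = 0)
    (hXQ₂ : dataMatrix x 0 T * Q₂ = 0)
    (hXhQ₂ : dataMatrix (delayed x d₁) 0 T * Q₂ = dataMatrix x 0 T * Q₃) :
    IsUnit (dataMatrix x 0 T * Q₃) ∧
      ClosedLoopExpStable A₀ A₁ B
        (dataMatrix (delayed u d₂) 0 T * Q₁ * (dataMatrix x 0 T * Q₃)⁻¹) hbar := by
  have hY := isUnit_of_lmiMatrix_posDef hP hR₁ hR₂ hΦ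
  refine ⟨hY, ?_⟩
  obtain ⟨C, ρ, hC, hρ0, hρ1, hdec⟩ :=
    exists_exponential_decay_of_lmi hP hS hR₁ hR₂ hΦ hRS₁ hRS₂
  have hX₁ := dataMatrix_one_eq hdata
  generalize dataMatrix x 0 T = X₀ at *
  generalize dataMatrix x 1 T = X₁ at *
  generalize dataMatrix (delayed x d₁) 0 T = Xh at *
  generalize dataMatrix (delayed u d₂) 0 T = U at *
  set Y := X₀ * Q₃ with hYdef
  have hdet : IsUnit Y.det := (Matrix.isUnit_iff_isUnit_det _).1 hY
  set K := U * Q₁ * Y⁻¹ with hK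
  -- Each `Qᵢ` isolates one term of the data identity; this is where the unknown system matrices
  -- enter.
  have hM₃ : X₁ * Q₃ = A₀ * Y := by
    simp only [hX₁, Matrix.add_mul, Matrix.mul_assoc, hXhQ₃, hUQ₃, Matrix.mul_zero, add_zero, hYdef]
  have hM₂ : X₁ * Q₂ = A₁ * Y := by
    simp only [hX₁, Matrix.add_mul, Matrix.mul_assoc, hXQ₂, hUQ₂, hXhQ₂, Matrix.mul_zero, add_zero,
      zero_add]
  have hM₁ : X₁ * Q₁ = B * (K * Y) := by
    rw [hK, Matrix.nonsing_inv_mul_cancel_right _ _ hdet]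
    simp only [hX₁, Matrix.add_mul, Matrix.mul_assoc, hXQ₁, hXhQ₁, Matrix.mul_zero, zero_add]
  obtain ⟨G, hG, hgrow⟩ := exists_growth_bound A₀ A₁ B K hbar
  obtain ⟨y, hy, hYn⟩ := exists_euclNorm_mulVec_le Y
  obtain ⟨w, hw, hYinv⟩ := exists_euclNorm_mulVec_le Y⁻¹
  have hcancel : ∀ v, Y *ᵥ (Y⁻¹ *ᵥ v) = v := fun v => by
    rw [Matrix.mulVec_mulVec, Matrix.mul_nonsing_inv _ hdet, Matrix.one_mulVec]
  have hG0 : 0 < G := one_pos.trans_le hG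
  -- The `1` serves times up to `hbar`, `y * (C * w)` the later ones (the change of coordinates
  -- costs `y * w`); `G ^ (hbar + 1)` bounds the transient and `ρ ^ (hbar + 1)` undoes the time
  -- shift.
  refine ⟨(1 + y * (C * w)) * G ^ (hbar + 1) / ρ ^ (hbar + 1), ρ, by positivity, hρ0, hρ1,
    fun h₁ h₂ hh₁ hh₂ ξ v htraj M hM k => ?_⟩
  have hM0 : 0 ≤ M := (euclNorm_nonneg _).trans (hM 0 (by omega) le_rfl)
  have hinit := hgrow h₁ h₂ hh₁ hh₂ ξ v htraj M hM (hbar + 1)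
  have hcoef : (1 + y * (C * w)) * G ^ (hbar + 1) / ρ ^ (hbar + 1) * ρ ^ k * M =
      (1 + y * (C * w)) * (G ^ (hbar + 1) * M) * (ρ ^ k / ρ ^ (hbar + 1)) := by ring
  rw [hcoef]
  have hGM : 0 ≤ G ^ (hbar + 1) * M := by positivity
  rcases le_or_gt k hbar with hk | hk
  · refine (hinit k (by omega) (by push_cast; omega)).trans ?_
    have h1 : 1 ≤ ρ ^ k / ρ ^ (hbar + 1) := by
      rw [one_le_div (by positivity)]
      exact pow_le_pow_of_le_one hρ0.le hρ1.le (by omega)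
    have h2 : 1 ≤ 1 + y * (C * w) := le_add_of_nonneg_right (by positivity)
    rw [mul_right_comm]
    exact le_mul_of_one_le_left hGM (one_le_mul_of_one_le_of_one_le h2 h1)
  · obtain ⟨j, rfl⟩ := Nat.exists_eq_add_of_le' (Nat.succ_le_of_lt hk)
    -- Index `i` stands for time `i + 1`: the initial window is `1, …, hbar + 1`, and every input
    -- used from then on has positive time, where the feedback law holds.
    have hz := hdec (fun i => Y⁻¹ *ᵥ ξ ((i : ℤ) + 1))
      (fun k => hbar - h₁ (k + hbar + 1)) (fun k => hbar - h₂ (k + hbar + 1))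
      (fun k => Nat.sub_le _ _) (fun k => Nat.sub_le _ _) (fun k => ?_)
      (w * (G ^ (hbar + 1) * M)) (fun l hl => ?_) j
    · have h3 := hYn (Y⁻¹ *ᵥ ξ (((j + hbar : ℕ) : ℤ) + 1))
      rw [hcancel] at h3
      have h4 := h3.trans (mul_le_mul_of_nonneg_left hz hy)
      have h5 : ρ ^ (j + hbar.succ) / ρ ^ (hbar + 1) = ρ ^ j := by
        rw [pow_add, Nat.succ_eq_add_one, mul_div_cancel_right₀ _ (by positivity)]
      have h6 : ((j + hbar.succ : ℕ) : ℤ) = ((j + hbar : ℕ) : ℤ) + 1 := by push_cast; ring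
      rw [h5, h6]
      have h7 : 0 ≤ G ^ (hbar + 1) * M * ρ ^ j := by positivity
      linarith
    · have i₁ := hh₁ (k + hbar + 1)
      have i₂ := hh₂ (k + hbar + 1)
      have h3 := htraj.1 (k + hbar + 1)
      rw [SystemEqAt, htraj.2.1 _ (by push_cast; omega)] at h3
      simp only [hM₁, hM₂, hM₃, ← Matrix.mulVec_mulVec, hcancel]
      have e₀ : ((k + hbar + 1 : ℕ) : ℤ) = ((k + hbar : ℕ) : ℤ) + 1 := by push_cast; ring
      have e₁ : ((k + hbar + 1 : ℕ) : ℤ) - (h₁ (k + hbar + 1) : ℤ)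
          = ((k + (hbar - h₁ (k + hbar + 1)) : ℕ) : ℤ) + 1 := by omega
      have e₂ : ((k + hbar + 1 : ℕ) : ℤ) - (h₂ (k + hbar + 1) : ℤ)
          = ((k + (hbar - h₂ (k + hbar + 1)) : ℕ) : ℤ) + 1 := by omega
      rw [e₁, e₂] at h3
      rw [h3, e₀]
    · refine (hYinv _).trans (mul_le_mul_of_nonneg_left ?_ hw)
      exact hinit _ (by omega) (by push_cast; omega)
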